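/- Let $I$ be an index set. For each $v\in I$ let $A_v$ and $A'_v$ be $C^*$-algebras with distinguished projections $p_v\in A_v$, $p'_v\in A'_v$ (all but finitely many of the $p_v$ and all but finitely many of the $p'_v$ being nonzero), let $X_v$ be a right Hilbert $C^*$-module over $A_v$ with a vector $x_v\in X_v$, and let $\alpha_v:A'_v\to \mathrm{End}^*_{A_v}(X_v)$ be a $*$-homomorphism into the adjointable operators. Assume that $(X_v,x_v)_{v\in I}$ is a collection of $((A'_v,p'_v),(A_v,p_v))_{v\in I}$-correspondences, that is, for all but finitely many $v$ one has $\langle x_v,x_v\rangle=p_v$ and $\alpha_v(p'_v)x_v=x_v$. Suppose that for all but finitely many $v\in I$ the following three conditions hold: (1) the balanced tensor product with $X_v$, i.e. $(\pi,\mathcal H)\mapsto(\alpha_v\otimes_\pi 1,\;X_v\otimes_{A_v}\mathcal H)$, takes irreducible representations of $A_v$ to irreducible representations of $A'_v$ (irreducible representations being nonzero representations on Hilbert spaces without proper nonzero closed invariant subspaces); (2) the projection $p'_v$ has rank at most one, i.e. $\sigma(p'_v)$ has rank at most one for every irreducible representation $\sigma$ of $A'_v$; (3) if the balanced tensor product with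 $X_v$ takes an irreducible representation $\pi_v$ of $A_v$ to a representation $\pi'_v$ of $A'_v$ such that $\pi'_v(p'_v)\neq 0$, then $\pi_v(p_v)\neq 0$. Then $(X_v,x_v)_{v\in I}$ is a coherent collection of correspondences: for all but finitely many $v\in I$, $$\alpha_v(p'_v)=p_{x_v},\qquad\text{where } p_{x_v}\xi:=x_v\langle x_v,\xi\rangle \text{ for }\xi\in X_v .$$ -/

import Mathlib

open Filter MulOpposite
open scoped TensorProduct InnerProductSpace

universe u w

noncomputable section

set_option linter.unusedSectionVars false

namespace HilbertCStar

/-! ### Right Hilbert modules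

Mathlib's `CStarModule B E` is a left module over `B`: the `B`-valued inner product is conjugate
linear in the first variable and satisfies `⟪x, b • y⟫ = b * ⟪x, y⟫`. Hence a right Hilbert module
over `A` is a complete `CStarModule Aᵐᵒᵖ X`, with `x · a = op a • x`. -/

section Module

variable {A X : Type*} [NonUnitalCStarAlgebra A] [PartialOrder A] [StarOrderedRing A]
  [NormedAddCommGroup X] [NormedSpace ℂ X] [SMul Aᵐᵒᵖ X] [CStarModule Aᵐᵒᵖ X]

variable (A) in
/-- The `A`-valued inner product of a right Hilbert `A`-module, conjugate linear in the first
variable, with `⟨x, y · a⟩ = ⟨x, y⟩ a`. -/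
def ip (x y : X) : A := unop (inner Aᵐᵒᵖ x y)

lemma ip_add_right (x y z : X) : ip A x (y + z) = ip A x y + ip A x z := by simp [ip]

lemma ip_add_left (x y z : X) : ip A (x + y) z = ip A x z + ip A y z := by simp [ip]

lemma ip_smul_right (c : ℂ) (x y : X) : ip A x (c • y) = c • ip A x y := by simp [ip]

lemma ip_smul_left (c : ℂ) (x y : X) : ip A (c • x) y = star c • ip A x y := by simp [ip]

lemma ip_sub_right (x y z : X) : ip A x (y - z) = ip A x y - ip A x z := by simp [ip]

lemma ip_zero_right (x : X) : ip A x 0 = 0 := by simp [ip]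

lemma ip_zero_left (x : X) : ip A 0 x = 0 := by simp [ip]

lemma ip_op_smul_right (x y : X) (a : A) : ip A x (op a • y) = ip A x y * a := by simp [ip]

lemma ip_op_smul_left (x y : X) (a : A) : ip A (op a • x) y = star a * ip A x y := by simp [ip]

lemma star_ip (x y : X) : star (ip A x y) = ip A y x := by
  rw [ip, ip, ← CStarModule.star_inner x y, unop_star]

lemma ip_self_nonneg (x : X) : 0 ≤ ip A x x :=
  CStarModule.inner_self_nonneg (A := Aᵐᵒᵖ) (x := x)

variable (A) in
lemma eq_of_ip_eq {x y : X} (h : ∀ z, ip A z x = ip A z y) : x = y := by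
  have h0 : ip A (x - y) (x - y) = 0 := by rw [ip_sub_right, h, sub_self]
  exact sub_eq_zero.mp (CStarModule.inner_self.mp (unop_injective (h0.trans unop_zero.symm)))

lemma ip_sum_left {ι : Type*} (s : Finset ι) (x : ι → X) (y : X) :
    ip A (∑ i ∈ s, x i) y = ∑ i ∈ s, ip A (x i) y := by
  simp [ip]

lemma ip_sum_right {ι : Type*} (s : Finset ι) (x : X) (y : ι → X) :
    ip A x (∑ i ∈ s, y i) = ∑ i ∈ s, ip A x (y i) := by
  simp [ip]

variable (A X) in
/-- `End_A^*(X)`: the adjointable operators on a right Hilbert `A`-module `X`, that is, the maps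
`T : X → X` for which there is `T* : X → X` with `⟨T x, y⟩ = ⟨x, T* y⟩`. (The map `T*` is unique;
`ℂ`-linearity and `A`-linearity of `T` are automatic, and so is boundedness if `X` is complete.) -/
structure Adjointable where
  toFun : X → X
  adj : X → X
  ip_toFun : ∀ x y, ip A (toFun x) y = ip A x (adj y)

namespace Adjointable

lemma ip_adj (T : Adjointable A X) (x y : X) : ip A (T.adj x) y = ip A x (T.toFun y) := by
  rw [← star_ip, ← T.ip_toFun, star_ip]

lemma ext {S T : Adjointable A X} (h : ∀ x, S.toFun x = T.toFun x) : S = T := by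
  have h1 : S.toFun = T.toFun := funext h
  have h2 : S.adj = T.adj := funext fun y => eq_of_ip_eq A fun z => by
    rw [← S.ip_toFun, ← T.ip_toFun, h1]
  cases S
  cases T
  simp_all

lemma map_add' (T : Adjointable A X) (x y : X) : T.toFun (x + y) = T.toFun x + T.toFun y :=
  eq_of_ip_eq A fun z => by rw [← ip_adj, ip_add_right, ip_add_right, ip_adj, ip_adj]

lemma map_smul' (T : Adjointable A X) (c : ℂ) (x : X) : T.toFun (c • x) = c • T.toFun x :=
  eq_of_ip_eq A fun z => by rw [← ip_adj, ip_smul_right, ip_smul_right, ip_adj]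

instance : Zero (Adjointable A X) :=
  ⟨⟨fun _ => 0, fun _ => 0, fun x y => by rw [ip_zero_left, ip_zero_right]⟩⟩

instance : One (Adjointable A X) := ⟨⟨fun x => x, fun x => x, fun _ _ => rfl⟩⟩

instance : Add (Adjointable A X) :=
  ⟨fun S T => ⟨fun x => S.toFun x + T.toFun x, fun x => S.adj x + T.adj x, fun x y => by
    rw [ip_add_left, ip_add_right, S.ip_toFun, T.ip_toFun]⟩⟩

instance : SMul ℂ (Adjointable A X) :=
  ⟨fun c T => ⟨fun x => c • T.toFun x, fun x => star c • T.adj x, fun x y => by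
    rw [ip_smul_left, ip_smul_right, T.ip_toFun]⟩⟩

instance : Neg (Adjointable A X) := ⟨fun T => (-1 : ℂ) • T⟩

instance : Mul (Adjointable A X) :=
  ⟨fun S T => ⟨fun x => S.toFun (T.toFun x), fun x => T.adj (S.adj x), fun x y => by
    rw [S.ip_toFun, T.ip_toFun]⟩⟩

instance : Star (Adjointable A X) := ⟨fun T => ⟨T.adj, T.toFun, T.ip_adj⟩⟩

@[simp] lemma zero_toFun (x : X) : (0 : Adjointable A X).toFun x = 0 := rfl
@[simp] lemma one_toFun (x : X) : (1 : Adjointable A X).toFun x = x := rfl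
@[simp] lemma add_toFun (S T : Adjointable A X) (x : X) :
    (S + T).toFun x = S.toFun x + T.toFun x := rfl
@[simp] lemma smul_toFun (c : ℂ) (T : Adjointable A X) (x : X) :
    (c • T).toFun x = c • T.toFun x := rfl
@[simp] lemma neg_toFun (T : Adjointable A X) (x : X) : (-T).toFun x = -T.toFun x :=
  neg_one_smul ℂ _
@[simp] lemma mul_toFun (S T : Adjointable A X) (x : X) :
    (S * T).toFun x = S.toFun (T.toFun x) := rfl
@[simp] lemma star_toFun (T : Adjointable A X) (x : X) : (star T).toFun x = T.adj x := rfl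

instance : Ring (Adjointable A X) where
  add_assoc _ _ _ := ext fun _ => by simp [add_assoc]
  zero_add _ := ext fun _ => by simp
  add_zero _ := ext fun _ => by simp
  add_comm _ _ := ext fun _ => by simp [add_comm]
  neg_add_cancel _ := ext fun _ => by simp
  mul_assoc _ _ _ := ext fun _ => by simp
  one_mul _ := ext fun _ => by simp
  mul_one _ := ext fun _ => by simp
  zero_mul _ := ext fun _ => by simp
  mul_zero T := ext fun x => by simpa using T.map_smul' 0 0
  left_distrib S _ _ := ext fun _ => by simp [S.map_add']
  right_distrib _ _ _ := ext fun _ => by simp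
  nsmul := nsmulRec
  zsmul := zsmulRec

instance : StarRing (Adjointable A X) where
  star_involutive _ := ext fun _ => rfl
  star_mul _ _ := ext fun _ => rfl
  star_add _ _ := ext fun _ => rfl

instance : Module ℂ (Adjointable A X) where
  one_smul _ := ext fun _ => by simp
  mul_smul _ _ _ := ext fun _ => by simp [mul_smul]
  smul_zero _ := ext fun _ => by simp
  smul_add _ _ _ := ext fun _ => by simp
  add_smul _ _ _ := ext fun _ => by simp [add_smul]
  zero_smul _ := ext fun _ => by simp

end Adjointable

variable (A) in
/-- The rank one operator `T_{ξ,η} : x ↦ ξ · ⟨η, x⟩`, whose adjoint is `T_{η,ξ}`. -/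
def rankOne (ξ η : X) : Adjointable A X where
  toFun x := op (ip A η x) • ξ
  adj x := op (ip A ξ x) • η
  ip_toFun x y := by rw [ip_op_smul_left, ip_op_smul_right, star_ip]

end Module

/-! ### Representations on Hilbert spaces -/

section Rep

variable {A H : Type*} [NonUnitalCStarAlgebra A]
  [NormedAddCommGroup H] [InnerProductSpace ℂ H] [CompleteSpace H]

/-- A representation of a `C*`-algebra on a Hilbert space is (topologically) irreducible if it is
nonzero and the only closed invariant subspaces are `0` and the whole space. -/
def IsIrreducible (π : A →⋆ₙₐ[ℂ] (H →L[ℂ] H)) : Prop :=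
  π ≠ 0 ∧ ∀ K : Submodule ℂ H, IsClosed (K : Set H) → (∀ a : A, ∀ h ∈ K, π a h ∈ K) →
    K = ⊥ ∨ K = ⊤

end Rep

/-- A projection `p` of a `C*`-algebra `A` has rank at most one if `π(p)` has rank at most one for
every irreducible representation `π` of `A`. -/
def HasRankAtMostOne {A : Type u} [NonUnitalCStarAlgebra A] (p : A) : Prop :=
  ∀ (H : Type u) [NormedAddCommGroup H] [InnerProductSpace ℂ H] [CompleteSpace H]
    (π : A →⋆ₙₐ[ℂ] (H →L[ℂ] H)), IsIrreducible π →
      Module.rank ℂ (LinearMap.range (π p : H →ₗ[ℂ] H)) ≤ 1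

/-! ### The balanced tensor product -/

section Balanced

variable {A X H : Type*} [NonUnitalCStarAlgebra A] [PartialOrder A] [StarOrderedRing A]
  [NormedAddCommGroup X] [NormedSpace ℂ X] [SMul Aᵐᵒᵖ X] [CStarModule Aᵐᵒᵖ X]
  [NormedAddCommGroup H] [InnerProductSpace ℂ H] [CompleteSpace H]

set_option linter.unusedVariables false in
variable (X) in
/-- The algebraic tensor product of `X` and `H` over `ℂ`, to be equipped with the semi-inner
product `⟨x ⊗ h, y ⊗ k⟩ = ⟨h, π(⟨x, y⟩) k⟩`. -/
@[nolint unusedArguments]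
def PreBalanced (π : A →⋆ₙₐ[ℂ] (H →L[ℂ] H)) : Type _ := X ⊗[ℂ] H

namespace PreBalanced

variable (π : A →⋆ₙₐ[ℂ] (H →L[ℂ] H))

instance : AddCommGroup (PreBalanced X π) := inferInstanceAs (AddCommGroup (X ⊗[ℂ] H))
instance : Module ℂ (PreBalanced X π) := inferInstanceAs (Module ℂ (X ⊗[ℂ] H))

/-- The elementary tensor `x ⊗ h`. -/
def tmul (x : X) (h : H) : PreBalanced X π := x ⊗ₜ[ℂ] h

/-- The linear functional `y ⊗ k ↦ ⟨h, π(⟨x, y⟩) k⟩`. -/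
def formAux (x : X) (h : H) : PreBalanced X π →ₗ[ℂ] ℂ :=
  TensorProduct.lift (LinearMap.mk₂ ℂ (fun y k => ⟪h, π (ip A x y) k⟫_ℂ)
    (fun y y' k => by simp [ip_add_right])
    (fun c y k => by simp [ip_smul_right])
    (fun y k k' => by simp)
    (fun c y k => by simp))

lemma formAux_tmul (x : X) (h : H) (y : X) (k : H) :
    formAux π x h (tmul π y k) = ⟪h, π (ip A x y) k⟫_ℂ :=
  rfl

lemma hom_ext {M : Type*} [AddCommGroup M] [Module ℂ M] {f g : PreBalanced X π →ₗ[ℂ] M}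
    (h : ∀ x k, f (tmul π x k) = g (tmul π x k)) : f = g :=
  TensorProduct.ext' h

/-- The sesquilinear form determined by `⟨x ⊗ h, y ⊗ k⟩ = ⟨h, π(⟨x, y⟩) k⟩`. -/
def form : PreBalanced X π →ₗ⋆[ℂ] PreBalanced X π →ₗ[ℂ] ℂ :=
  TensorProduct.lift (LinearMap.mk₂'ₛₗ (starRingEnd ℂ) (starRingEnd ℂ) (formAux (X := X) π)
    (fun x x' h => hom_ext π fun y k => by
      simp [formAux_tmul, ip_add_left])
    (fun c x h => hom_ext π fun y k => by
      simp [formAux_tmul, ip_smul_left])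
    (fun x h h' => hom_ext π fun y k => by
      simp [formAux_tmul])
    (fun c x h => hom_ext π fun y k => by
      simp [formAux_tmul, mul_comm]))

lemma form_tmul (x : X) (h : H) (y : X) (k : H) :
    form π (tmul π x h) (tmul π y k) = ⟪h, π (ip A x y) k⟫_ℂ :=
  rfl

lemma exists_sum (z : PreBalanced X π) :
    ∃ s : Finset (X × H), z = ∑ i ∈ s, tmul π i.1 i.2 :=
  TensorProduct.exists_finset z

lemma ind {P : PreBalanced X π → Prop} (z : PreBalanced X π) (h0 : P 0)
    (h1 : ∀ x h, P (tmul π x h)) (h2 : ∀ z w, P z → P w → P (z + w)) : P z :=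
  TensorProduct.induction_on z h0 h1 h2

lemma conj_form (z w : PreBalanced X π) : starRingEnd ℂ (form π w z) = form π z w := by
  induction z using ind with
  | h0 => simp
  | h2 z z' h h' => simp [h, h']
  | h1 x h =>
    induction w using ind with
    | h0 => simp
    | h2 z z' h h' => simp [h, h']
    | h1 y k =>
      rw [form_tmul, form_tmul, inner_conj_symm, ← star_ip x y, map_star,
        ContinuousLinearMap.star_eq_adjoint, ContinuousLinearMap.adjoint_inner_left]

end PreBalanced

lemma exists_conj_eq_neg {B : Type*} [NonUnitalCStarAlgebra B] (b : B) (hb : IsSelfAdjoint b) :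
    ∃ c r : B, star c * b * c = -(star r * r) ∧ (r = 0 → ∃ m : B, b = star m * m) := by
  let _ := CStarAlgebra.spectralOrder B
  have _ := CStarAlgebra.spectralOrderedRing B
  have hs : star b⁻ = b⁻ := (CFC.negPart_nonneg b).isSelfAdjoint
  obtain ⟨s, hs'⟩ := CStarAlgebra.nonneg_iff_eq_star_mul_self.mp (CFC.negPart_nonneg b)
  have h3 : star (s * b⁻) * (s * b⁻) = b⁻ * b⁻ * b⁻ := by
    rw [star_mul, hs, mul_assoc, ← mul_assoc (star s), ← hs', mul_assoc]
  refine ⟨b⁻, s * b⁻, ?_, fun hr => ?_⟩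
  · rw [h3, hs]
    have h4 : b⁻ * b = -(b⁻ * b⁻) := by
      have h5 := congrArg (fun t => b⁻ * t) (CFC.posPart_sub_negPart b hb)
      simp only [mul_sub, CFC.negPart_mul_posPart, zero_sub] at h5
      exact h5.symm
    rw [h4, neg_mul]
  · rw [hr, mul_zero] at h3
    have h4 : star (b⁻ * b⁻) * (b⁻ * b⁻) = 0 := by
      rw [star_mul, hs, ← mul_assoc, ← h3, zero_mul]
    have h5 : star b⁻ * b⁻ = 0 := by
      rw [hs]
      exact CStarRing.star_mul_self_eq_zero_iff _ |>.mp h4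
    have h6 := CStarRing.star_mul_self_eq_zero_iff _ |>.mp h5
    exact CStarAlgebra.nonneg_iff_eq_star_mul_self.mp ((CFC.negPart_eq_zero_iff b hb).mp h6)

lemma cstarMatrix_mul_apply {B n : Type*} [NonUnitalCStarAlgebra B] [Fintype n]
    (M N : CStarMatrix n n B) (i j : n) :
    (M * N) i j = ∑ k, M i k * N k j := rfl

/-- A self-adjoint matrix `P` over a `C*`-algebra with `∑ aᵢ* Pᵢⱼ aⱼ ≥ 0` for all columns `a` is of
the form `M* M`. -/
lemma exists_matrix {n : Type*} [Fintype n] (P : n → n → A) (hP : ∀ i j, star (P i j) = P j i)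
    (h : ∀ a : n → A, 0 ≤ ∑ i, ∑ j, star (a i) * P i j * a j) :
    ∃ M : n → n → A, ∀ i j, P i j = ∑ k, star (M k i) * M k j := by
  classical
  let Q : CStarMatrix n n A := CStarMatrix.ofMatrix (Matrix.of P)
  have hQ : IsSelfAdjoint Q := by
    ext i j
    exact hP j i
  obtain ⟨c, r, h1, h2⟩ := exists_conj_eq_neg Q hQ
  have h3 (k : n) : ∑ i, star (r i k) * r i k = 0 := by
    have e1 : (star c * Q * c) k k = ∑ i, ∑ j, star (c i k) * P i j * c j k := by
      rw [cstarMatrix_mul_apply]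
      simp_rw [cstarMatrix_mul_apply, Finset.sum_mul]
      rw [Finset.sum_comm]
      rfl
    have e2 : (-(star r * r)) k k = -∑ i, star (r i k) * r i k := by
      rw [CStarMatrix.neg_apply, cstarMatrix_mul_apply]
      rfl
    have e3 : 0 ≤ -∑ i, star (r i k) * r i k := by
      rw [← e2, ← h1, e1]
      exact h _
    exact le_antisymm (neg_nonneg.mp e3) (Finset.sum_nonneg fun i _ => star_mul_self_nonneg _)
  have h4 : r = 0 := by
    ext i k
    have := (Finset.sum_eq_zero_iff_of_nonneg
      (fun i _ => star_mul_self_nonneg (r i k))).mp (h3 k) i (Finset.mem_univ i)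
    exact CStarRing.star_mul_self_eq_zero_iff _ |>.mp this
  obtain ⟨M, hM⟩ := h2 h4
  refine ⟨fun k i => M k i, fun i j => ?_⟩
  have := congrArg (fun N : CStarMatrix n n A => N i j) hM
  simp only [cstarMatrix_mul_apply] at this
  exact this

namespace PreBalanced

variable (π : A →⋆ₙₐ[ℂ] (H →L[ℂ] H))

lemma form_self_nonneg (z : PreBalanced X π) : 0 ≤ (form π z z).re := by
  obtain ⟨s, rfl⟩ := exists_sum π z
  obtain ⟨M, hM⟩ := exists_matrix (A := A) (n := s) (fun i j => ip A i.1.1 j.1.1)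
    (fun i j => star_ip _ _) (fun a => by
      have : ∑ i : s, ∑ j : s, star (a i) * ip A i.1.1 j.1.1 * a j =
          ip A (∑ i : s, op (a i) • i.1.1) (∑ i : s, op (a i) • i.1.1) := by
        rw [ip_sum_left]
        simp_rw [ip_sum_right, ip_op_smul_left, ip_op_smul_right, mul_assoc]
      rw [this]
      exact ip_self_nonneg _)
  have key : form π (∑ i ∈ s, tmul π i.1 i.2) (∑ i ∈ s, tmul π i.1 i.2) =
      ∑ k : s, ⟪∑ i : s, π (M k i) i.1.2, ∑ i : s, π (M k i) i.1.2⟫_ℂ := by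
    have e (i j : s) : form π (tmul π i.1.1 i.1.2) (tmul π j.1.1 j.1.2) =
        ∑ k : s, ⟪π (M k i) i.1.2, π (M k j) j.1.2⟫_ℂ := by
      rw [form_tmul, hM, map_sum, _root_.sum_apply, inner_sum]
      refine Finset.sum_congr rfl fun k _ => ?_
      rw [map_mul, map_star, mul_apply_eq_comp, ContinuousLinearMap.star_eq_adjoint,
        ContinuousLinearMap.adjoint_inner_right]
    rw [← Finset.sum_coe_sort s]
    simp only [map_sum, LinearMap.sum_apply, e, sum_inner, inner_sum]
    rw [Finset.sum_comm_cycle]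
  rw [key, Complex.re_sum]
  exact Finset.sum_nonneg fun k _ => inner_self_nonneg (𝕜 := ℂ)

/-- The semi-inner product `⟨x ⊗ h, y ⊗ k⟩ = ⟨h, π(⟨x, y⟩) k⟩`. -/
abbrev core : PreInnerProductSpace.Core ℂ (PreBalanced X π) where
  inner z w := form π z w
  conj_inner_symm z w := conj_form π z w
  re_inner_nonneg z := form_self_nonneg π z
  add_left _ _ _ := by simp
  smul_left _ _ _ := by simp

instance : SeminormedAddCommGroup (PreBalanced X π) :=
  InnerProductSpace.Core.toSeminormedAddCommGroup (c := core π)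

instance : InnerProductSpace ℂ (PreBalanced X π) := InnerProductSpace.ofCore (core π)

lemma inner_def (z w : PreBalanced X π) : ⟪z, w⟫_ℂ = form π z w := rfl

/-- The operator `T ⊗ 1`, `x ⊗ h ↦ T x ⊗ h`, for `T` adjointable. -/
def ampl (T : Adjointable A X) : PreBalanced X π →ₗ[ℂ] PreBalanced X π :=
  TensorProduct.map ⟨⟨T.toFun, T.map_add'⟩, T.map_smul'⟩ LinearMap.id

@[simp] lemma ampl_tmul (T : Adjointable A X) (x : X) (h : H) :
    ampl π T (tmul π x h) = tmul π (T.toFun x) h := rfl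

lemma ampl_add (S T : Adjointable A X) : ampl π (S + T) = ampl π S + ampl π T :=
  hom_ext π fun _ _ => TensorProduct.add_tmul _ _ _

lemma ampl_smul (c : ℂ) (T : Adjointable A X) : ampl π (c • T) = c • ampl π T :=
  hom_ext π fun _ _ => (TensorProduct.smul_tmul' _ _ _).symm

lemma ampl_mul (S T : Adjointable A X) : ampl π (S * T) = ampl π S ∘ₗ ampl π T :=
  hom_ext π fun _ _ => rfl

lemma ampl_zero : ampl π (0 : Adjointable A X) = 0 :=
  hom_ext π fun _ h => TensorProduct.zero_tmul _ h

lemma inner_ampl (T : Adjointable A X) (z w : PreBalanced X π) :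
    ⟪ampl π T z, w⟫_ℂ = ⟪z, ampl π (star T) w⟫_ℂ := by
  simp only [inner_def]
  induction z using ind with
  | h0 => simp
  | h2 z z' h h' => simp [h, h']
  | h1 x h =>
    induction w using ind with
    | h0 => simp
    | h2 z z' h h' => simp only [map_add, h, h']
    | h1 y k =>
      rw [ampl_tmul, ampl_tmul, form_tmul, form_tmul, T.ip_toFun, Adjointable.star_toFun]

end PreBalanced

/-- The balanced tensor product `X ⊗_A H` of a right Hilbert `A`-module `X` and a representation
`(π, H)` of `A`: the Hilbert space obtained from `X ⊗ H` and the semi-inner product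
`⟨x ⊗ h, y ⊗ k⟩ = ⟨h, π(⟨x, y⟩) k⟩` by separation and completion. -/
abbrev Balanced (X : Type*) {A H : Type*} [NonUnitalCStarAlgebra A] [PartialOrder A]
    [StarOrderedRing A] [NormedAddCommGroup X] [NormedSpace ℂ X] [SMul Aᵐᵒᵖ X]
    [CStarModule Aᵐᵒᵖ X] [NormedAddCommGroup H] [InnerProductSpace ℂ H] [CompleteSpace H]
    (π : A →⋆ₙₐ[ℂ] (H →L[ℂ] H)) : Type _ :=
  UniformSpace.Completion (PreBalanced X π)

variable {A' : Type*} [NonUnitalCStarAlgebra A']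

lemma norm_ampl_le (α : A' →⋆ₙₐ[ℂ] Adjointable A X) (π : A →⋆ₙₐ[ℂ] (H →L[ℂ] H)) (a : A')
    (z : PreBalanced X π) : ‖PreBalanced.ampl π (α a) z‖ ≤ ‖a‖ * ‖z‖ := by
  let _ := CStarAlgebra.spectralOrder (Unitization ℂ A')
  have _ := CStarAlgebra.spectralOrderedRing (Unitization ℂ A')
  have h0 := sub_nonneg.mpr
    (CStarAlgebra.star_mul_le_algebraMap_norm_sq (a := (a : Unitization ℂ A')))
  obtain ⟨c, hc⟩ := CStarAlgebra.nonneg_iff_eq_star_mul_self.mp h0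
  rw [sub_eq_iff_eq_add] at hc
  have hfst : ((‖a‖ ^ 2 : ℝ) : ℂ) = star c.fst * c.fst := by
    have := congrArg (fun t : Unitization ℂ A' => t.fst) hc
    simpa [Unitization.norm_inr, Algebra.algebraMap_eq_smul_one] using this
  have hsnd : -(star a * a) = star c.fst • c.snd + c.fst • star c.snd + star c.snd * c.snd := by
    rw [eq_comm, ← add_eq_zero_iff_eq_neg, eq_comm]
    have := congrArg (fun t : Unitization ℂ A' => t.snd) hc
    simpa [Algebra.algebraMap_eq_smul_one] using this
  set S := PreBalanced.ampl π (α a)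
  set T := PreBalanced.ampl π (α c.snd)
  have hS : ⟪S z, S z⟫_ℂ = ⟪z, PreBalanced.ampl π (α (star a * a)) z⟫_ℂ := by
    rw [PreBalanced.inner_ampl, map_mul, map_star, PreBalanced.ampl_mul]
    rfl
  have hT : ⟪T z, T z⟫_ℂ = ⟪z, PreBalanced.ampl π (α (star c.snd * c.snd)) z⟫_ℂ := by
    rw [PreBalanced.inner_ampl, map_mul, map_star, PreBalanced.ampl_mul]
    rfl
  have hT' : ⟪T z, z⟫_ℂ = ⟪z, PreBalanced.ampl π (α (star c.snd)) z⟫_ℂ := by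
    rw [PreBalanced.inner_ampl, map_star]
  have hs : -⟪S z, S z⟫_ℂ =
      star c.fst * ⟪z, T z⟫_ℂ + c.fst * ⟪T z, z⟫_ℂ + ⟪T z, T z⟫_ℂ := by
    have h1 := congrArg (fun b => ⟪z, PreBalanced.ampl π (α b) z⟫_ℂ) hsnd
    have h2 : -(star a * a) = (-1 : ℂ) • (star a * a) := (neg_one_smul ℂ _).symm
    rw [h2] at h1
    simp only [map_smul, map_add, PreBalanced.ampl_add, PreBalanced.ampl_smul,
      LinearMap.add_apply, LinearMap.smul_apply, inner_add_right, inner_smul_right, neg_mul,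
      one_mul] at h1
    rw [hS, hT, hT', h1]
  have hu : ⟪c.fst • z + T z, c.fst • z + T z⟫_ℂ =
      ((‖a‖ ^ 2 : ℝ) : ℂ) * ⟪z, z⟫_ℂ - ⟪S z, S z⟫_ℂ := by
    rw [hfst, sub_eq_add_neg, hs]
    simp only [inner_add_left, inner_add_right, inner_smul_left, inner_smul_right]
    simp only [RCLike.star_def]
    ring
  simp only [inner_self_eq_norm_sq_to_K] at hu
  have hu' : ‖c.fst • z + T z‖ ^ 2 = ‖a‖ ^ 2 * ‖z‖ ^ 2 - ‖S z‖ ^ 2 := by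
    apply Complex.ofReal_injective
    push_cast at hu ⊢
    exact hu
  refine le_of_sq_le_sq ?_ (by positivity)
  nlinarith [sq_nonneg ‖c.fst • z + T z‖]

/-- The operator `α(a) ⊗ 1` on `X ⊗ H`, as a bounded operator. -/
def amplL (α : A' →⋆ₙₐ[ℂ] Adjointable A X) (π : A →⋆ₙₐ[ℂ] (H →L[ℂ] H)) (a : A') :
    PreBalanced X π →L[ℂ] PreBalanced X π :=
  (PreBalanced.ampl π (α a)).mkContinuous ‖a‖ (norm_ampl_le α π a)

lemma amplL_apply (α : A' →⋆ₙₐ[ℂ] Adjointable A X) (π : A →⋆ₙₐ[ℂ] (H →L[ℂ] H)) (a : A')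
    (z : PreBalanced X π) : amplL α π a z = PreBalanced.ampl π (α a) z := rfl

lemma completion_amplL_smul (α : A' →⋆ₙₐ[ℂ] Adjointable A X) (π : A →⋆ₙₐ[ℂ] (H →L[ℂ] H))
    (c : ℂ) (a : A') : (amplL α π (c • a)).completion = c • (amplL α π a).completion := by
  ext z
  induction z using UniformSpace.Completion.induction_on with
  | hp =>
    exact isClosed_eq (amplL α π (c • a)).completion.continuous
      (c • (amplL α π a).completion).continuous
  | ih z => simp [amplL_apply, PreBalanced.ampl_smul]

/-- The representation `α ⊗_π 1` of `A'` on `X ⊗_A H`, `a ↦ (x ⊗ h ↦ α(a) x ⊗ h)`. -/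
def induced (α : A' →⋆ₙₐ[ℂ] Adjointable A X) (π : A →⋆ₙₐ[ℂ] (H →L[ℂ] H)) :
    A' →⋆ₙₐ[ℂ] (Balanced X π →L[ℂ] Balanced X π) where
  toFun a := (amplL α π a).completion
  map_smul' c a := completion_amplL_smul α π c a
  map_zero' := by simpa using completion_amplL_smul α π 0 0
  map_add' a b := by
    ext z
    induction z using UniformSpace.Completion.induction_on with
    | hp => apply isClosed_eq <;> fun_prop
    | ih z => simp [amplL_apply, PreBalanced.ampl_add, UniformSpace.Completion.coe_add]
  map_mul' a b := by
    ext z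
    induction z using UniformSpace.Completion.induction_on with
    | hp => apply isClosed_eq <;> fun_prop
    | ih z => simp [amplL_apply, PreBalanced.ampl_mul]
  map_star' a := by
    refine (ContinuousLinearMap.eq_adjoint_iff _ _).mpr fun z w => ?_
    induction z, w using UniformSpace.Completion.induction_on₂ with
    | hp => apply isClosed_eq <;> fun_prop
    | ih z w =>
      rw [ContinuousLinearMap.completion_apply_coe, ContinuousLinearMap.completion_apply_coe,
        UniformSpace.Completion.inner_coe, UniformSpace.Completion.inner_coe, amplL_apply,
        amplL_apply, PreBalanced.inner_ampl, map_star, star_star]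

end Balanced

/-! ### Collections of correspondences -/

section Collections

variable {I : Type w} {A A' X : I → Type u}
  [∀ v, NonUnitalCStarAlgebra (A v)] [∀ v, PartialOrder (A v)] [∀ v, StarOrderedRing (A v)]
  [∀ v, NonUnitalCStarAlgebra (A' v)]
  [∀ v, NormedAddCommGroup (X v)] [∀ v, NormedSpace ℂ (X v)]
  [∀ v, SMul (A v)ᵐᵒᵖ (X v)] [∀ v, CStarModule (A v)ᵐᵒᵖ (X v)]

/-- A family of distinguished projections, of which all but finitely many are nonzero. -/
structure IsProjectionFamily {B : I → Type u} [∀ v, NonUnitalCStarAlgebra (B v)]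
    (p : ∀ v, B v) : Prop where
  isStarProjection : ∀ v, IsStarProjection (p v)
  ne_zero : ∀ᶠ v in cofinite, p v ≠ 0

/-- The collection `(X_v, x_v)` of Hilbert modules is compatible with `(A_v, p_v)`:
`⟨x_v, x_v⟩ = p_v` for all but finitely many `v`. -/
def IsCompatible (p : ∀ v, A v) (x : ∀ v, X v) : Prop :=
  ∀ᶠ v in cofinite, ip (A v) (x v) (x v) = p v

/-- `(X_v, x_v)` together with the left actions `α_v : A'_v → End^*(X_v)` is a collection of
`((A'_v, p'_v), (A_v, p_v))`-correspondences. -/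
structure IsCorrespondenceCollection (p' : ∀ v, A' v) (p : ∀ v, A v) (x : ∀ v, X v)
    (α : ∀ v, A' v →⋆ₙₐ[ℂ] Adjointable (A v) (X v)) : Prop where
  left_projections : IsProjectionFamily p'
  right_projections : IsProjectionFamily p
  compatible : IsCompatible p x
  left_compatible : ∀ᶠ v in cofinite, (α v (p' v)).toFun (x v) = x v

/-- Coherence: `α_v(p'_v)` is the rank one operator `p_{x_v} = T_{x_v, x_v}`, for all but finitely
many `v`. -/
def IsCoherent (p' : ∀ v, A' v) (x : ∀ v, X v)
    (α : ∀ v, A' v →⋆ₙₐ[ℂ] Adjointable (A v) (X v)) : Prop :=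
  ∀ᶠ v in cofinite, α v (p' v) = rankOne (A v) (x v) (x v)

end Collections

end HilbertCStar

end

/-! The claim is checked at each index outside a finite exceptional set. There `α p'` is a
projection fixing `x`, and `⟨x, x⟩ = p` is a projection, so `x⟨x, x⟩ = x`. For any `y` the vector `ξ
= α(p')y - x⟨x, y⟩` is therefore fixed by `α p'` and orthogonal to `x`, and it must be shown to
vanish (`eq_zero_of_fixed_of_orthogonal`).

If `ξ ≠ 0`, some irreducible `π` of `A` has `π⟨ξ, ξ⟩ ≠ 0`, so some `ξ ⊗ h` is nonzero. It is fixed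
by the induced action of `p'`, which is thus nonzero; condition (3) gives `π(p) ≠ 0`, hence some `x
⊗ k ≠ 0`, also fixed. These two vectors are orthogonal because `⟨x, ξ⟩ = 0`, yet by (1) and (2) they
lie in a space of dimension at most one: a contradiction.

The analytic input is `exists_irreducible`: irreducible representations detect nonzero positive
elements. Krein–Milman supplies an extreme quasi-state not vanishing at the element, and its GNS
representation is irreducible. Quasi-states are used because, without a unit, the states need not be
weak-* compact. -/

noncomputable section

set_option linter.unusedSectionVars false

namespace HilbertCStar

/-! ### Extreme quasi-states -/

section QuasiState

open scoped ComplexOrder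

variable {A : Type*} [NonUnitalCStarAlgebra A] [PartialOrder A]

variable (A) in
/-- The positive linear functionals of norm at most one, with the weak-* topology. -/
def quasiStates : Set (WeakDual ℂ A) :=
  {f | (∀ a : A, 0 ≤ a → 0 ≤ f a) ∧ ∀ a : A, ‖f a‖ ≤ ‖a‖}

lemma isCompact_quasiStates : IsCompact (quasiStates A) := by
  refine (WeakDual.isCompact_closedBall (𝕜 := ℂ) (E := A) 0 1).of_isClosed_subset ?_ ?_
  · simp only [quasiStates, Set.ofPred_and, Set.ofPred_forall]
    refine IsClosed.inter (isClosed_iInter fun a => isClosed_iInter fun _ => ?_)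
      (isClosed_iInter fun a => ?_)
    · exact isClosed_Ici.preimage (WeakDual.eval_continuous a)
    · exact isClosed_le (WeakDual.eval_continuous a).norm continuous_const
  · intro f hf
    rw [Set.mem_preimage, mem_closedBall_zero_iff]
    exact ContinuousLinearMap.opNorm_le_bound _ zero_le_one fun a => by
      rw [one_mul]
      exact hf.2 a

variable [StarOrderedRing A]

/-- Hahn–Banach separates `-a` from the closed cone of positive elements. A functional bounded below
on a cone is nonnegative there. -/
lemma exists_re_pos {a : A} (ha : 0 ≤ a) (ha0 : a ≠ 0) :
    ∃ f : StrongDual ℂ A, (∀ b : A, 0 ≤ b → 0 ≤ (f b).re) ∧ 0 < (f a).re := by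
  have hna : -a ∉ {b : A | 0 ≤ b} := fun h =>
    ha0 (le_antisymm (neg_nonneg.mp h) ha)
  have hconv : Convex ℝ {b : A | 0 ≤ b} := convex_Ici 0
  have hcl : IsClosed {b : A | 0 ≤ b} := isClosed_Ici
  obtain ⟨f, u, hu, hf⟩ := RCLike.geometric_hahn_banach_point_closed (𝕜 := ℂ) hconv hcl hna
  have hu0 : u < 0 := by simpa using hf 0 le_rfl
  simp only [map_neg, RCLike.re_to_complex] at hu hf
  refine ⟨f, fun b hb => ?_, by linarith⟩
  by_contra! hneg
  -- This nonnegative multiple of `b` is scaled so that `f` has real part exactly `u` there, which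
  -- the strict bound forbids.
  have h1 := hf ((u / (f b).re) • b)
    (smul_nonneg (div_nonneg_of_nonpos hu0.le hneg.le) hb)
  rw [← Complex.coe_smul, map_smul, smul_eq_mul, Complex.re_ofReal_mul,
    div_mul_cancel₀ _ hneg.ne] at h1
  exact lt_irrefl _ h1

lemma exists_mem_quasiStates {a : A} (ha : 0 ≤ a) (ha0 : a ≠ 0) :
    ∃ f ∈ quasiStates A, 0 < (f a).re := by
  obtain ⟨f, hf, hfa⟩ := exists_re_pos ha ha0
  -- Symmetrising `f` gives a functional equal to `2 Re f` on positive elements, hence real there.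
  let g : A →ₗ[ℂ] ℂ :=
    { toFun b := f b + star (f (star b))
      map_add' b c := by simp only [star_add, map_add]; ring
      map_smul' c b := by simp [mul_add] }
  have hg (b : A) : ‖g b‖ ≤ 2 * ‖f‖ * ‖b‖ := by
    refine (norm_add_le _ _).trans ?_
    have h1 := f.le_opNorm b
    have h2 := f.le_opNorm (star b)
    rw [norm_star] at h2 ⊢
    linarith
  have hg' {b : A} (hb : 0 ≤ b) : g b = ((2 * (f b).re : ℝ) : ℂ) := by
    change f b + star (f (star b)) = _
    rw [(IsSelfAdjoint.of_nonneg hb).star_eq, RCLike.star_def, Complex.add_conj]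
  -- Since `‖g‖ ≤ 2‖f‖`, this factor brings the norm to at most one; the `+ 1` keeps the denominator
  -- positive.
  set r : ℝ := (2 * ‖f‖ + 1)⁻¹
  have hr : 0 < r := by positivity
  let G : StrongDual ℂ A := (r : ℂ) • g.mkContinuous _ hg
  have hG (b : A) : G b = (r : ℂ) * g b := rfl
  refine ⟨StrongDual.toWeakDual G, ⟨fun b hb => ?_, fun b => ?_⟩, ?_⟩
  · change 0 ≤ G b
    rw [hG, hg' hb, ← Complex.ofReal_mul, Complex.zero_le_real]
    exact mul_nonneg hr.le (mul_nonneg zero_le_two (hf b hb))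
  · change ‖G b‖ ≤ _
    rw [hG, norm_mul, Complex.norm_real, Real.norm_of_nonneg hr.le]
    rw [inv_mul_le_iff₀ (by positivity)]
    exact (hg b).trans (by gcongr; linarith)
  · change 0 < (G a).re
    rw [hG, hg' ha, ← Complex.ofReal_mul, Complex.ofReal_re]
    positivity

/-- The quasi-states maximising `Re f(a)` form a nonempty compact exposed face. Krein–Milman gives
it an extreme point, which is extreme among all quasi-states, and the maximum is positive. -/
lemma exists_extreme_quasiState {a : A} (ha : 0 ≤ a) (ha0 : a ≠ 0) :
    ∃ f ∈ (quasiStates A).extremePoints ℝ, f a ≠ 0 := by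
  obtain ⟨f₀, hf₀, hpos⟩ := exists_mem_quasiStates ha ha0
  let l : StrongDual ℝ (WeakDual ℂ A) :=
    { toFun f := (f a).re
      map_add' f g := rfl
      map_smul' c f := by
        change (c • f a).re = c • (f a).re
        simp
      cont := Complex.continuous_re.comp (WeakDual.eval_continuous a) }
  have hexp : IsExposed ℝ (quasiStates A) (l.toExposed (quasiStates A)) :=
    ContinuousLinearMap.toExposed.isExposed
  have _ : LocallyConvexSpace ℝ (WeakDual ℂ A) :=
    WeakBilin.locallyConvexSpace (B := topDualPairing ℂ A)
  obtain ⟨m, hm, hmax⟩ := isCompact_quasiStates.exists_isMaxOn ⟨f₀, hf₀⟩ l.continuous.continuousOn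
  obtain ⟨f, hf⟩ := (hexp.isCompact isCompact_quasiStates).extremePoints_nonempty
    ⟨m, hm, fun g hg => hmax hg⟩
  refine ⟨f, hexp.isExtreme.extremePoints_subset_extremePoints hf, fun h0 => ?_⟩
  have h1 : (f₀ a).re ≤ (f a).re := hf.1.2 f₀ hf₀
  rw [h0, Complex.zero_re] at h1
  linarith

end QuasiState

/-! ### Irreducibility of the GNS representation -/

section VectorFunctional

open scoped ComplexOrder

variable {A H : Type*} [NonUnitalCStarAlgebra A] [PartialOrder A] [StarOrderedRing A]
  [NormedAddCommGroup H] [InnerProductSpace ℂ H] [CompleteSpace H]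

lemma norm_inner_rep_le (π : A →⋆ₙₐ[ℂ] (H →L[ℂ] H)) (k : H) (a : A) :
    ‖⟪k, π a k⟫_ℂ‖ ≤ ‖k‖ ^ 2 * ‖a‖ := by
  calc ‖⟪k, π a k⟫_ℂ‖ ≤ ‖k‖ * ‖π a k‖ := norm_inner_le_norm _ _
    _ ≤ ‖k‖ * (‖a‖ * ‖k‖) := by
      gcongr
      exact (π a).le_of_opNorm_le (NonUnitalStarAlgHom.norm_apply_le π a) k
    _ = ‖k‖ ^ 2 * ‖a‖ := by ring

/-- The functional `a ↦ ⟨k, π(a) k⟩`. -/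
def vectorFunctional (π : A →⋆ₙₐ[ℂ] (H →L[ℂ] H)) (k : H) : WeakDual ℂ A :=
  StrongDual.toWeakDual <| LinearMap.mkContinuous
    { toFun a := ⟪k, π a k⟫_ℂ
      map_add' a b := by simp
      map_smul' c a := by simp } (‖k‖ ^ 2) (norm_inner_rep_le π k)

lemma vectorFunctional_apply (π : A →⋆ₙₐ[ℂ] (H →L[ℂ] H)) (k : H) (a : A) :
    vectorFunctional π k a = ⟪k, π a k⟫_ℂ := rfl

lemma vectorFunctional_nonneg (π : A →⋆ₙₐ[ℂ] (H →L[ℂ] H)) (k : H) {a : A} (ha : 0 ≤ a) :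
    0 ≤ vectorFunctional π k a := by
  obtain ⟨b, rfl⟩ := CStarAlgebra.nonneg_iff_eq_star_mul_self.mp ha
  rw [vectorFunctional_apply, map_mul, map_star, mul_apply_eq_comp,
    ContinuousLinearMap.star_eq_adjoint, ContinuousLinearMap.adjoint_inner_right,
    inner_self_eq_norm_sq_to_K]
  rw [← RCLike.ofReal_pow]
  exact RCLike.ofReal_nonneg.mpr (sq_nonneg ‖π b k‖)

lemma smul_vectorFunctional_mem (π : A →⋆ₙₐ[ℂ] (H →L[ℂ] H)) (k : H) {r : ℝ} (hr : 0 ≤ r)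
    (hrk : r * ‖k‖ ^ 2 ≤ 1) : r • vectorFunctional π k ∈ quasiStates A := by
  refine ⟨fun a ha => ?_, fun a => ?_⟩
  · exact smul_nonneg hr (vectorFunctional_nonneg π k ha)
  · change ‖r • vectorFunctional π k a‖ ≤ _
    rw [norm_smul, Real.norm_of_nonneg hr]
    calc r * ‖vectorFunctional π k a‖ ≤ r * (‖k‖ ^ 2 * ‖a‖) := by
          gcongr
          exact norm_inner_rep_le π k a
      _ = r * ‖k‖ ^ 2 * ‖a‖ := by ring
      _ ≤ ‖a‖ := mul_le_of_le_one_left (norm_nonneg a) hrk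

/-- With `t = ‖k‖²` and `t' = ‖l‖²`, the sum is the convex combination, with weights `t/(t+t')` and
`t'/(t+t')`, of the two functionals divided by their weights. Each rescaled functional has norm at
most `t + t' ≤ 1`, so extremality makes it equal to the sum. -/
lemma vectorFunctional_eq_of_extreme (π : A →⋆ₙₐ[ℂ] (H →L[ℂ] H)) {k l : H} (hk : k ≠ 0)
    (hl : l ≠ 0) (hkl : ‖k‖ ^ 2 + ‖l‖ ^ 2 ≤ 1)
    (h : vectorFunctional π k + vectorFunctional π l ∈ (quasiStates A).extremePoints ℝ) :
    ∃ s : ℝ, 0 < s ∧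
      vectorFunctional π k = s • (vectorFunctional π k + vectorFunctional π l) := by
  have hk' : 0 < ‖k‖ ^ 2 := pow_pos (norm_pos_iff.mpr hk) 2
  have hl' : 0 < ‖l‖ ^ 2 := pow_pos (norm_pos_iff.mpr hl) 2
  set t := ‖k‖ ^ 2
  set t' := ‖l‖ ^ 2
  have hs : 0 < t / (t + t') := by positivity
  have hs' : 0 < t' / (t + t') := by positivity
  have hinv {r : ℝ} (hr : 0 < r) (f : WeakDual ℂ A) : r • r⁻¹ • f = f :=
    DFunLike.ext _ _ fun a => smul_inv_smul₀ hr.ne' (f a)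
  have h1 := (mem_extremePoints_iff_left.mp h).2
    ((t / (t + t'))⁻¹ • vectorFunctional π k)
    (smul_vectorFunctional_mem π k (by positivity) (by
      change (t / (t + t'))⁻¹ * t ≤ 1
      rwa [inv_div, div_mul_cancel₀ _ hk'.ne']))
    ((t' / (t + t'))⁻¹ • vectorFunctional π l)
    (smul_vectorFunctional_mem π l (by positivity) (by
      change (t' / (t + t'))⁻¹ * t' ≤ 1
      rwa [inv_div, div_mul_cancel₀ _ hl'.ne']))
    ⟨t / (t + t'), t' / (t + t'), hs, hs', by field_simp, by
      rw [hinv hs, hinv hs']⟩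
  exact ⟨t / (t + t'), hs, by rw [← h1, hinv hs]⟩

/-- A representation with a cyclic vector that implements an extreme quasi-state is irreducible. -/
lemma isIrreducible_of_extreme (π : A →⋆ₙₐ[ℂ] (H →L[ℂ] H)) {ξ : H} (hξ : ‖ξ‖ ≤ 1)
    (hcyc : DenseRange fun a => π a ξ)
    (h : vectorFunctional π ξ ∈ (quasiStates A).extremePoints ℝ) (hπ : π ≠ 0) :
    IsIrreducible π := by
  refine ⟨hπ, fun K hK hinv => ?_⟩
  have _ : CompleteSpace K := hK.completeSpace_coe
  have hinv' (a : A) (x : H) (hx : x ∈ Kᗮ) : π a x ∈ Kᗮ := by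
    intro y hy
    rw [← ContinuousLinearMap.adjoint_inner_left, ← ContinuousLinearMap.star_eq_adjoint,
      ← map_star]
    exact hx _ (hinv _ _ hy)
  have htop {L : Submodule ℂ H} (hL : IsClosed (L : Set H))
      (hLinv : ∀ a : A, ∀ x ∈ L, π a x ∈ L) (hξL : ξ ∈ L) : L = ⊤ :=
    eq_top_iff.mpr fun x _ =>
      closure_minimal (Set.range_subset_iff.mpr fun a => hLinv a ξ hξL) hL (hcyc x)
  -- As `K` and `Kᗮ` are both invariant, the cross terms vanish and the functional of `ξ` splits as
  -- the sum of those of `k` and `l`.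
  obtain ⟨k, hkK, l, hlK, hkl⟩ := K.exists_add_mem_mem_orthogonal ξ
  have hadd (a : A) : ⟪k, π a ξ⟫_ℂ = ⟪k, π a k⟫_ℂ := by
    rw [hkl, map_add, inner_add_right, hinv' a l hlK k hkK, add_zero]
  have hsum : vectorFunctional π ξ = vectorFunctional π k + vectorFunctional π l := by
    refine DFunLike.ext _ _ fun a => ?_
    change ⟪ξ, π a ξ⟫_ℂ = ⟪k, π a k⟫_ℂ + ⟪l, π a l⟫_ℂ
    rw [hkl, map_add, inner_add_left, inner_add_right, inner_add_right, hinv' a l hlK k hkK,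
      Submodule.inner_left_of_mem_orthogonal (hinv a k hkK) hlK, add_zero, zero_add]
  by_cases hl : l = 0
  · right
    refine htop hK hinv ?_
    rwa [hkl, hl, add_zero]
  by_cases hk : k = 0
  · left
    refine (Submodule.orthogonal_eq_top_iff K).mp
      (htop K.isClosed_orthogonal hinv' ?_)
    rwa [hkl, hk, zero_add]
  exfalso
  have hnorm : ‖k‖ ^ 2 + ‖l‖ ^ 2 ≤ 1 := by
    have h1 := norm_add_sq_eq_norm_sq_add_norm_sq_of_inner_eq_zero (𝕜 := ℂ) k l (hlK k hkK)
    rw [← hkl] at h1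
    nlinarith [norm_nonneg ξ]
  obtain ⟨s, hs, hks⟩ := vectorFunctional_eq_of_extreme π hk hl hnorm (hsum ▸ h)
  rw [← hsum] at hks
  -- Proportional functionals make `k - sξ` orthogonal to every `π(a)ξ`, and these are dense. Since
  -- `s ≠ 0`, both `ξ` and `l` then lie in `K`, forcing `l = 0`.
  have hmul : k = (s : ℂ) • ξ := by
    rw [← sub_eq_zero]
    refine hcyc.eq_zero_of_inner_left ℂ ?_
    intro a
    have h1 : ⟪k, π a k⟫_ℂ = s • ⟪ξ, π a ξ⟫_ℂ := congrArg (fun f : WeakDual ℂ A => f a) hks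
    rw [inner_sub_left, hadd, h1, inner_smul_left, Complex.conj_ofReal, Complex.real_smul, sub_self]
  have hξK : ξ ∈ K := by
    have h1 : ξ = (s : ℂ)⁻¹ • k := by
      rw [hmul, inv_smul_smul₀ (Complex.ofReal_ne_zero.mpr hs.ne')]
    exact h1 ▸ K.smul_mem _ hkK
  have hlK' : l ∈ K := by
    rw [← add_sub_cancel_left k l, ← hkl]
    exact K.sub_mem hξK hkK
  exact hl (inner_self_eq_zero (𝕜 := ℂ) |>.mp (hlK l hlK'))

end VectorFunctional

/-! ### The cyclic vector in the GNS space, and separation of points -/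

section GNS

open scoped ComplexOrder

variable {A : Type u} [NonUnitalCStarAlgebra A] [PartialOrder A] [StarOrderedRing A]

open PositiveLinearMap in
lemma norm_apply_le_norm_toPreGNS (φ : A →ₚ[ℂ] ℂ) (hφ : ∀ a, ‖φ a‖ ≤ ‖a‖) (b : A) :
    ‖φ b‖ ≤ ‖φ.toPreGNS b‖ := by
  -- An approximate unit replaces the missing `1`: `φ(eb) = ⟨e, b⟩` is bounded by Cauchy–Schwarz,
  -- with `‖e‖² = φ(e*e) ≤ 1` in the GNS seminorm.
  have hA := CStarAlgebra.increasingApproximateUnit A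
  have hlim : Tendsto (fun e => ‖φ (e * b)‖) (CStarAlgebra.approximateUnit A) (nhds ‖φ b‖) :=
    (((map_continuous φ).tendsto b).comp (hA.tendsto_mul_right b)).norm
  refine le_of_tendsto hlim ?_
  filter_upwards [hA.eventually_star_eq, hA.eventually_norm] with e he he1
  have h1 : φ (e * b) = ⟪φ.toPreGNS e, φ.toPreGNS b⟫_ℂ := by
    rw [preGNS_inner_def, ofPreGNS_toPreGNS, ofPreGNS_toPreGNS, he]
  have h2 : ‖φ.toPreGNS e‖ ≤ 1 := by
    have h3 := congrArg norm (preGNS_norm_sq φ (φ.toPreGNS e))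
    rw [ofPreGNS_toPreGNS, ← Complex.ofReal_pow, Complex.norm_real, norm_pow, norm_norm] at h3
    have h4 := hφ (star e * e)
    rw [CStarRing.norm_star_mul_self] at h4
    nlinarith [norm_nonneg e, norm_nonneg (φ.toPreGNS e)]
  rw [h1]
  exact (norm_inner_le_norm _ _).trans (mul_le_of_le_one_left (norm_nonneg _) h2)

open PositiveLinearMap in
/-- The cyclic vector of the GNS representation of a quasi-state. -/
lemma exists_cyclic_vector (φ : A →ₚ[ℂ] ℂ) (hφ : ∀ a, ‖φ a‖ ≤ ‖a‖) :
    ∃ ξ : φ.GNS, ‖ξ‖ ≤ 1 ∧ (∀ a, φ.gnsNonUnitalStarAlgHom a ξ = (φ.toPreGNS a : φ.GNS)) ∧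
      ∀ a, ⟪ξ, φ.gnsNonUnitalStarAlgHom a ξ⟫_ℂ = φ a := by
  -- The bound makes `φ` itself continuous for the GNS seminorm; the cyclic vector is the Riesz
  -- representative of its extension to the completion.
  let g : φ.PreGNS →L[ℂ] ℂ :=
    ((φ : A →ₗ[ℂ] ℂ) ∘ₗ φ.ofPreGNS.toLinearMap).mkContinuous 1 fun b => by
      rw [one_mul]
      exact norm_apply_le_norm_toPreGNS φ hφ (φ.ofPreGNS b)
  let G : φ.GNS →L[ℂ] ℂ := g.extend (UniformSpace.Completion.toComplL : φ.PreGNS →L[ℂ] φ.GNS)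
  have hG (b : A) : G (φ.toPreGNS b : φ.GNS) = φ b :=
    ContinuousLinearMap.extend_eq g UniformSpace.Completion.denseRange_coe
      (UniformSpace.Completion.isUniformInducing_coe _) _
  let ξ : φ.GNS := (InnerProductSpace.toDual ℂ φ.GNS).symm G
  have hξ (b : A) : ⟪ξ, (φ.toPreGNS b : φ.GNS)⟫_ℂ = φ b := by
    rw [InnerProductSpace.toDual_symm_apply, hG]
  have hπ (a : A) : φ.gnsNonUnitalStarAlgHom a ξ = (φ.toPreGNS a : φ.GNS) := by
    rw [← sub_eq_zero]
    -- Both vectors pair with the class of `b` to give `φ(b*a)`, and such classes are dense.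
    refine (UniformSpace.Completion.denseRange_coe (α := φ.PreGNS)).eq_zero_of_inner_right ℂ ?_
    intro b
    obtain ⟨b, rfl⟩ := φ.toPreGNS.surjective b
    have h1 : ⟪(φ.toPreGNS b : φ.GNS), φ.gnsNonUnitalStarAlgHom a ξ⟫_ℂ = φ (star b * a) := by
      rw [← ContinuousLinearMap.adjoint_inner_left, ← ContinuousLinearMap.star_eq_adjoint,
        ← map_star, gnsNonUnitalStarAlgHom_apply_coe, leftMulMapPreGNS_apply, ← inner_conj_symm]
      have h2 := hξ (star a * b)
      rw [← Complex.star_def]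
      erw [h2]
      rw [← map_star φ, star_mul, star_star]
    rw [inner_sub_right, h1, UniformSpace.Completion.inner_coe, preGNS_inner_def,
      ofPreGNS_toPreGNS, ofPreGNS_toPreGNS, sub_self]
  refine ⟨ξ, ?_, hπ, fun a => by rw [hπ, hξ]⟩
  have hbound (z : φ.GNS) : ‖⟪ξ, z⟫_ℂ‖ ≤ ‖z‖ := by
    induction z using UniformSpace.Completion.induction_on with
    | hp => apply isClosed_le <;> fun_prop
    | ih b =>
      obtain ⟨b, rfl⟩ := φ.toPreGNS.surjective b
      rw [hξ, UniformSpace.Completion.norm_coe]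
      exact norm_apply_le_norm_toPreGNS φ hφ b
  -- Taking `z = ξ` yields `‖ξ‖² ≤ ‖ξ‖`.
  have h3 := hbound ξ
  rw [inner_self_eq_norm_sq_to_K, norm_pow, RCLike.norm_ofReal, abs_norm] at h3
  nlinarith [norm_nonneg ξ]

/-- Irreducible representations separate the points of a `C*`-algebra. -/
theorem exists_irreducible {a : A} (ha : 0 ≤ a) (ha0 : a ≠ 0) :
    ∃ (H : Type u) (_ : NormedAddCommGroup H) (_ : InnerProductSpace ℂ H) (_ : CompleteSpace H)
      (π : A →⋆ₙₐ[ℂ] (H →L[ℂ] H)), IsIrreducible π ∧ π a ≠ 0 := by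
  obtain ⟨f, hf, hfa⟩ := exists_extreme_quasiState ha ha0
  let φ : A →ₚ[ℂ] ℂ := PositiveLinearMap.mk₀ (WeakDual.toStrongDual f : A →ₗ[ℂ] ℂ) hf.1.1
  obtain ⟨ξ, hξ1, hξ, hφ⟩ := exists_cyclic_vector φ hf.1.2
  have hπa : φ.gnsNonUnitalStarAlgHom a ≠ 0 := fun h0 => by
    have h1 := hφ a
    rw [h0, zero_apply, inner_zero_right] at h1
    exact hfa h1.symm
  -- The GNS space lives in the universe of `A`, the one over which the hypotheses of the theorem
  -- quantify.
  refine ⟨φ.GNS, inferInstance, inferInstance, inferInstance, φ.gnsNonUnitalStarAlgHom,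
    isIrreducible_of_extreme _ hξ1 ?_ ?_ fun h0 => hπa (by rw [h0]; rfl), hπa⟩
  · have h1 : (fun a => φ.gnsNonUnitalStarAlgHom a ξ) =
        ((↑) : φ.PreGNS → φ.GNS) ∘ φ.toPreGNS := funext hξ
    rw [h1]
    exact UniformSpace.Completion.denseRange_coe.comp φ.toPreGNS.surjective.denseRange
      (UniformSpace.Completion.continuous_coe _)
  · have h1 : vectorFunctional φ.gnsNonUnitalStarAlgHom ξ = f := DFunLike.ext _ _ hφ
    rwa [h1]

end GNS

/-! ### Coherence at a single index -/

lemma eq_zero_or_eq_zero_of_rank_le_one {H : Type*} [NormedAddCommGroup H] [InnerProductSpace ℂ H]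
    {K : Submodule ℂ H} (hK : Module.rank ℂ K ≤ 1) {y z : H} (hy : y ∈ K) (hz : z ∈ K)
    (hyz : ⟪y, z⟫_ℂ = 0) : y = 0 ∨ z = 0 := by
  obtain ⟨e, -, he⟩ := (rank_submodule_le_one_iff K).mp hK
  obtain ⟨r, rfl⟩ := Submodule.mem_span_singleton.mp (he hy)
  obtain ⟨s, rfl⟩ := Submodule.mem_span_singleton.mp (he hz)
  rw [inner_smul_left, inner_smul_right] at hyz
  rcases mul_eq_zero.mp hyz with h | h
  · left
    rw [(map_eq_zero _).mp h, zero_smul]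
  rcases mul_eq_zero.mp h with h | h
  · right
    rw [h, zero_smul]
  · left
    rw [inner_self_eq_zero.mp h, smul_zero]

/-! ### Elementary tensors in the balanced tensor product -/

section Balanced

variable {A A' X H : Type*} [NonUnitalCStarAlgebra A] [PartialOrder A] [StarOrderedRing A]
  [NonUnitalCStarAlgebra A'] [NormedAddCommGroup X] [NormedSpace ℂ X] [SMul Aᵐᵒᵖ X]
  [CStarModule Aᵐᵒᵖ X] [NormedAddCommGroup H] [InnerProductSpace ℂ H] [CompleteSpace H]

/-- The elementary tensor `y ⊗ h` in the balanced tensor product. -/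
def btmul (π : A →⋆ₙₐ[ℂ] (H →L[ℂ] H)) (y : X) (h : H) : Balanced X π :=
  (PreBalanced.tmul π y h : PreBalanced X π)

lemma inner_btmul (π : A →⋆ₙₐ[ℂ] (H →L[ℂ] H)) (y z : X) (h k : H) :
    ⟪btmul π y h, btmul π z k⟫_ℂ = ⟪h, π (ip A y z) k⟫_ℂ := by
  rw [btmul, btmul, UniformSpace.Completion.inner_coe, PreBalanced.inner_def,
    PreBalanced.form_tmul]

lemma induced_btmul (α : A' →⋆ₙₐ[ℂ] Adjointable A X) (π : A →⋆ₙₐ[ℂ] (H →L[ℂ] H)) (a : A') (y : X)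
    (h : H) : induced α π a (btmul π y h) = btmul π ((α a).toFun y) h := by
  change (amplL α π a).completion (btmul π y h) = _
  rw [btmul, ContinuousLinearMap.completion_apply_coe, amplL_apply, PreBalanced.ampl_tmul, btmul]

lemma exists_btmul_ne_zero (π : A →⋆ₙₐ[ℂ] (H →L[ℂ] H)) {y : X} (hy : π (ip A y y) ≠ 0) :
    ∃ h, btmul π y h ≠ 0 := by
  by_contra! h0
  refine hy (ContinuousLinearMap.ext fun h => ext_inner_left ℂ fun k => ?_)
  rw [← inner_btmul, h0, h0, inner_zero_left, zero_apply, inner_zero_right]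

end Balanced

variable {A A' X : Type u} [NonUnitalCStarAlgebra A] [PartialOrder A] [StarOrderedRing A]
  [NonUnitalCStarAlgebra A'] [NormedAddCommGroup X] [NormedSpace ℂ X] [SMul Aᵐᵒᵖ X]
  [CStarModule Aᵐᵒᵖ X]

/-- With `q = ⟨x, x⟩`, idempotency gives `⟨xq - x, x⟩ = 0`, so `xq - x` has zero inner square. -/
lemma op_ip_self_smul {x : X} (hx : IsStarProjection (ip A x x)) : op (ip A x x) • x = x := by
  have hidem : ip A x x * ip A x x = ip A x x := hx.isIdempotentElem
  have h0 : ip A (op (ip A x x) • x - x) (op (ip A x x) • x - x) = 0 := by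
    have h1 : ip A (op (ip A x x) • x - x) x = 0 := by
      rw [← star_ip, ip_sub_right, ip_op_smul_right, hidem, sub_self, star_zero]
    rw [ip_sub_right, ip_op_smul_right, h1, zero_mul, sub_self]
  exact sub_eq_zero.mp (CStarModule.inner_self.mp (unop_injective (h0.trans unop_zero.symm)))

/-- A vector fixed by `α(p')` and orthogonal to `x` vanishes, if `x` is fixed by `α(p')`, `p'` has
rank at most one, and the balanced tensor product is compatible with irreducibility and with the
vanishing of the distinguished projections. -/
lemma eq_zero_of_fixed_of_orthogonal {p' : A'} {x ξ : X} {α : A' →⋆ₙₐ[ℂ] Adjointable A X}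
    (hpx : (α p').toFun x = x)
    (hirr : ∀ (H : Type u) [NormedAddCommGroup H] [InnerProductSpace ℂ H] [CompleteSpace H]
      (π : A →⋆ₙₐ[ℂ] (H →L[ℂ] H)), IsIrreducible π → IsIrreducible (induced α π))
    (hrank : HasRankAtMostOne p')
    (hne : ∀ (H : Type u) [NormedAddCommGroup H] [InnerProductSpace ℂ H] [CompleteSpace H]
      (π : A →⋆ₙₐ[ℂ] (H →L[ℂ] H)), IsIrreducible π → induced α π p' ≠ 0 → π (ip A x x) ≠ 0)
    (hpξ : (α p').toFun ξ = ξ) (hxξ : ip A x ξ = 0) : ξ = 0 := by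
  by_contra hξ
  have hξ' : ip A ξ ξ ≠ 0 := fun h0 =>
    hξ (CStarModule.inner_self.mp (unop_injective (h0.trans unop_zero.symm)))
  obtain ⟨H, _, _, _, π, hπ, hπξ⟩ := exists_irreducible (ip_self_nonneg ξ) hξ'
  obtain ⟨h, hh⟩ := exists_btmul_ne_zero π hπξ
  have hfix {y : X} (hy : (α p').toFun y = y) (k : H) :
      induced α π p' (btmul π y k) = btmul π y k := by rw [induced_btmul, hy]
  have hind : induced α π p' ≠ 0 := fun h0 => hh (by rw [← hfix hpξ, h0, zero_apply])
  obtain ⟨k, hk⟩ := exists_btmul_ne_zero π (hne H π hπ hind)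
  rcases eq_zero_or_eq_zero_of_rank_le_one (hrank _ _ (hirr H π hπ)) ⟨_, hfix hpx k⟩
    ⟨_, hfix hpξ h⟩ (by rw [inner_btmul, hxξ, map_zero, zero_apply, inner_zero_right]) with h0 | h0
  · exact hk h0
  · exact hh h0

/-- The difference of the two operators takes values fixed by `α p'`, by its idempotency and right
`A`-linearity, and orthogonal to `x`, because `α p'` is self-adjoint and fixes `x`. -/
lemma eq_rankOne {p' : A'} {x : X} {α : A' →⋆ₙₐ[ℂ] Adjointable A X}
    (hp' : IsStarProjection p') (hx : IsStarProjection (ip A x x)) (hpx : (α p').toFun x = x)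
    (hirr : ∀ (H : Type u) [NormedAddCommGroup H] [InnerProductSpace ℂ H] [CompleteSpace H]
      (π : A →⋆ₙₐ[ℂ] (H →L[ℂ] H)), IsIrreducible π → IsIrreducible (induced α π))
    (hrank : HasRankAtMostOne p')
    (hne : ∀ (H : Type u) [NormedAddCommGroup H] [InnerProductSpace ℂ H] [CompleteSpace H]
      (π : A →⋆ₙₐ[ℂ] (H →L[ℂ] H)), IsIrreducible π → induced α π p' ≠ 0 → π (ip A x x) ≠ 0) :
    α p' = rankOne A x x := by
  have hlin (b : A) : (α p').toFun (op b • x) = op b • x :=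
    eq_of_ip_eq A fun z => by
      rw [← Adjointable.ip_adj, ip_op_smul_right, ip_op_smul_right, Adjointable.ip_adj, hpx]
  have hidem (y : X) : (α p').toFun ((α p').toFun y) = (α p').toFun y := by
    rw [← Adjointable.mul_toFun, ← map_mul, hp'.isIdempotentElem.eq]
  have hself (y : X) : ip A x ((α p').toFun y) = ip A x y := by
    have h1 : (α p').adj x = x := by
      rw [← Adjointable.star_toFun, ← map_star, hp'.isSelfAdjoint.star_eq, hpx]
    rw [← Adjointable.ip_adj, h1]
  refine Adjointable.ext fun y => ?_
  change (α p').toFun y = op (ip A x y) • x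
  have hsub : (α p').toFun y - op (ip A x y) • x =
      (α p').toFun y + (-1 : ℂ) • (op (ip A x y) • x) := by
    rw [neg_one_smul, sub_eq_add_neg]
  refine sub_eq_zero.mp (eq_zero_of_fixed_of_orthogonal hpx hirr hrank hne ?_ ?_)
  · rw [hsub, Adjointable.map_add', Adjointable.map_smul', hidem, hlin]
  · have h1 : ip A x x * ip A x y = ip A x y := by
      rw [← star_ip x x, ← ip_op_smul_left, op_ip_self_smul hx]
    rw [ip_sub_right, hself, ip_op_smul_right, h1, sub_self]

end HilbertCStar

end

theorem proposition5 {I : Type w} {A A' X : I → Type u}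
    [∀ v, NonUnitalCStarAlgebra (A v)] [∀ v, PartialOrder (A v)] [∀ v, StarOrderedRing (A v)]
    [∀ v, NonUnitalCStarAlgebra (A' v)]
    [∀ v, NormedAddCommGroup (X v)] [∀ v, NormedSpace ℂ (X v)] [∀ v, CompleteSpace (X v)]
    [∀ v, SMul (A v)ᵐᵒᵖ (X v)] [∀ v, CStarModule (A v)ᵐᵒᵖ (X v)]
    (p' : ∀ v, A' v) (p : ∀ v, A v) (x : ∀ v, X v)
    (α : ∀ v, A' v →⋆ₙₐ[ℂ] HilbertCStar.Adjointable (A v) (X v))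
    (hX : HilbertCStar.IsCorrespondenceCollection p' p x α)
    (h : ∀ᶠ v in Filter.cofinite,
      (∀ (H : Type u) [NormedAddCommGroup H] [InnerProductSpace ℂ H] [CompleteSpace H]
        (π : A v →⋆ₙₐ[ℂ] (H →L[ℂ] H)), HilbertCStar.IsIrreducible π →
          HilbertCStar.IsIrreducible (HilbertCStar.induced (α v) π)) ∧
      HilbertCStar.HasRankAtMostOne (p' v) ∧
      (∀ (H : Type u) [NormedAddCommGroup H] [InnerProductSpace ℂ H] [CompleteSpace H]
        (π : A v →⋆ₙₐ[ℂ] (H →L[ℂ] H)), HilbertCStar.IsIrreducible π →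
          HilbertCStar.induced (α v) π (p' v) ≠ 0 → π (p v) ≠ 0)) :
    HilbertCStar.IsCoherent p' x α := by
  filter_upwards [hX.compatible, hX.left_compatible, h] with v hv hv' ⟨h1, h2, h3⟩
  rw [← hv] at h3
  exact HilbertCStar.eq_rankOne (hX.left_projections.isStarProjection v)
    (hv ▸ hX.right_projections.isStarProjection v) hv' h1 h2 h3
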